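/- All graphs are finite, undirected and simple. In a connected graph $M$ with distance $d$ let $I(u,v)=\{x\in V(M) : d(u,v)=d(u,x)+d(x,v)\}$; $M$ is \emph{median} if it is connected and $|I(u,v)\cap I(v,w)\cap I(w,u)|=1$ for all vertices $u,v,w$, and a set $S\subseteq V(M)$ is \emph{convex} if $I(u,v)\subseteq S$ for all $u,v\in S$. For an edge $ab$ of $M$ let $W_{ab}=\{v : d(v,a)<d(v,b)\}$ and let $U_{ab}$ be the set of vertices of $W_{ab}$ that have a neighbour in $W_{ba}$. A \emph{median decomposition} of a graph $G$ is a pair $(M,(X_a)_{a\in V(M)})$ of a median graph $M$ and sets $X_a\subseteq V(G)$ such that (M1) for every edge $uv$ of $G$ there is $a\in V(M)$ with $u,v\in X_a$, and (M2) for every $v\in V(G)$ the set $X^{-1}(v)=\{a\in V(M) : v\in X_a\}$ is non-empty and convex in $M$. Its \emph{width} is $\max_{a\in V(M)}|X_a|$. Put $Z_{ab}=\bigcup_{x\in U_{ab}}X_x$. The decomposition is \emph{$\Theta$-smooth} if (M3) for every edge $ab$ of $M$ we have $|Z_{ab}\setminus Z_{ba}|=|Z_{ba}\setminus Z_{ab}|=1$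 and, writing $Z_{ab}\setminus Z_{ba}=\{v_a\}$ and $Z_{ba}\setminus Z_{ab}=\{v_b\}$, the set $X^{-1}(v_a)\cup X^{-1}(v_b)$ is convex in $M$. The \emph{smooth medianwidth} $\mathrm{smw}(G)$ is the minimum width of a $\Theta$-smooth median decomposition of $G$. \textbf{Theorem.} For every graph $G$, the minimum defining $\mathrm{smw}(G)$ is attained (in particular $G$ has a $\Theta$-smooth median decomposition), and $\mathrm{smw}(G)=\chi(G)$, the chromatic number of $G$. -/

import Mathlib

namespace SimpleGraph

section Median

variable {M : Type*} (T : SimpleGraph M)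

/-- The interval `I(u, v)`: all vertices lying on a shortest path from `u` to `v`
(used for connected graphs). -/
def geodInterval (u v : M) : Set M :=
  {x | T.dist u v = T.dist u x + T.dist x v}

/-- A graph is median if it is connected and every three vertices have a unique median. -/
structure IsMedian : Prop where
  connected : T.Connected
  existsUnique_median : ∀ u v w : M,
    ∃! x, x ∈ T.geodInterval u v ∩ T.geodInterval v w ∩ T.geodInterval w u

/-- (Geodesically) convex sets of vertices. -/
def IsGeodConvex (S : Set M) : Prop :=
  ∀ u ∈ S, ∀ v ∈ S, T.geodInterval u v ⊆ S

/-- `W_{ab}`: the vertices strictly closer to `a` than to `b`. -/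
def wSet (a b : M) : Set M :=
  {v | T.dist v a < T.dist v b}

/-- `U_{ab}`: the vertices of `W_{ab}` that have a neighbour in `W_{ba}`. -/
def uSet (a b : M) : Set M :=
  {v | v ∈ T.wSet a b ∧ ∃ w ∈ T.wSet b a, T.Adj v w}

end Median

/-- A median decomposition of `G` with underlying median graph `T`:
a family of bags indexed by the vertices of `T` that satisfies (M1) and (M2). -/
structure MedianDecomposition {V M : Type*} (G : SimpleGraph V) (T : SimpleGraph M) where
  isMedian : T.IsMedian
  bag : M → Set V
  /-- (M1): both ends of each edge of `G` lie in a common bag. -/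
  exists_bag_of_adj : ∀ u v : V, G.Adj u v → ∃ a, u ∈ bag a ∧ v ∈ bag a
  /-- (M2), first half: every vertex of `G` lies in some bag. -/
  exists_bag : ∀ v : V, {a | v ∈ bag a}.Nonempty
  /-- (M2), second half: the bags containing a given vertex of `G` form a convex set of `T`. -/
  convex_bags : ∀ v : V, T.IsGeodConvex {a | v ∈ bag a}

namespace MedianDecomposition

variable {V M : Type*} {G : SimpleGraph V} {T : SimpleGraph M} (D : MedianDecomposition G T)

/-- `X⁻¹(v)`: the vertices of `T` whose bag contains `v`. -/
def support (v : V) : Set M :=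
  {a | v ∈ D.bag a}

/-- `Z_{ab}`: the union of the bags over `U_{ab}`. -/
def zSet (a b : M) : Set V :=
  ⋃ x ∈ T.uSet a b, D.bag x

/-- (M3), `Θ`-smoothness: for every edge `ab` of `T`, each of `Z_{ab} \ Z_{ba}` and
`Z_{ba} \ Z_{ab}` has exactly one element, `v_a` and `v_b` respectively, and
`X⁻¹(v_a) ∪ X⁻¹(v_b)` is convex in `T`. -/
def IsThetaSmooth : Prop :=
  ∀ a b : M, T.Adj a b → ∃ va vb : V,
    D.zSet a b \ D.zSet b a = {va} ∧ D.zSet b a \ D.zSet a b = {vb} ∧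
      T.IsGeodConvex (D.support va ∪ D.support vb)

/-- The width: the largest size of a bag. -/
noncomputable def width [Fintype M] : ℕ :=
  Finset.univ.sup fun a => (D.bag a).ncard

end MedianDecomposition

/-- The widths of the `Θ`-smooth median decompositions of `G` over finite median graphs. Every
finite graph is isomorphic to one whose vertices form a type in the lowest universe. -/
def smoothWidths {V : Type*} (G : SimpleGraph V) : Set ℕ∞ :=
  {k | ∃ (M : Type) (_ : Fintype M) (T : SimpleGraph M) (D : MedianDecomposition G T),
    D.IsThetaSmooth ∧ (D.width : ℕ∞) = k}

/-- The smooth medianwidth of `G`: the least width of a `Θ`-smooth median decomposition. -/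
noncomputable def smoothMedianwidth {V : Type*} (G : SimpleGraph V) : ℕ∞ :=
  sInf G.smoothWidths

end SimpleGraph

/-!
Let `X` be a `Θ`-smooth median decomposition. Opposite edges of a four-cycle of the median graph
have the same sets `W`, hence the same sets `Z`, and smoothness then forces the bags at the two ends
of an edge `ab` to differ exactly by the exchange of `v_a` for `v_b`. Label the edge with the
transposition of these two vertices of `G`. On a four-cycle, opposite edges carry the same label and
consecutive labels commute. Since any two geodesics of a median graph with common ends are connected
by moves across four-cycles, the labelling is the coboundary of a potential `π`, and `(π a)⁻¹` maps
`X_a` onto one fixed set. A vertex `v` has the same image under `(π a)⁻¹` for every bag `X_a` that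
contains it, because the set of these `a` is convex. This image is a colour of `v`, and it is
injective on each bag, so `G` is `|X_a|`-colourable.

Conversely, arrange each class of a colouring with `χ(G)` colours on a path. The vertices of the
product of these paths are the transversals of the classes. Taken as bags, they form a `Θ`-smooth
decomposition: along an edge of the product a single colour class changes its representative.
-/

section Distance

open SimpleGraph

variable {M : Type*} {T : SimpleGraph M}

theorem mem_geodInterval {u v x : M} :
    x ∈ T.geodInterval u v ↔ T.dist u v = T.dist u x + T.dist x v :=
  Iff.rfl

theorem mem_wSet {a b v : M} : v ∈ T.wSet a b ↔ T.dist v a < T.dist v b :=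
  Iff.rfl

theorem mem_uSet {a b v : M} :
    v ∈ T.uSet a b ↔ v ∈ T.wSet a b ∧ ∃ w ∈ T.wSet b a, T.Adj v w :=
  Iff.rfl

theorem left_mem_wSet {a b : M} (hab : T.Adj a b) : a ∈ T.wSet a b := by
  simp [mem_wSet, dist_eq_one_iff_adj.mpr hab]

theorem left_mem_uSet {a b : M} (hab : T.Adj a b) : a ∈ T.uSet a b :=
  ⟨left_mem_wSet hab, b, left_mem_wSet hab.symm, hab⟩

theorem exists_adj_dist_add_one_eq {a w : M} (h : T.Reachable a w) (hne : a ≠ w) :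
    ∃ b, T.Adj a b ∧ T.dist b w + 1 = T.dist a w := by
  obtain ⟨p, hp⟩ := h.exists_walk_length_eq_dist
  cases p with
  | nil => exact absurd rfl hne
  | @cons _ b _ hab q =>
    have hlength : q.length + 1 = T.dist a w := hp
    have htriangle := hab.reachable.dist_triangle_left w
    rw [dist_eq_one_iff_adj.mpr hab] at htriangle
    exact ⟨b, hab, by linarith [dist_le q]⟩

theorem exists_walk_length_eq_of_descent {g : M} {δ : M → ℕ} (hzero : δ g = 0)
    (hdescent : ∀ u, u ≠ g → ∃ v, T.Adj u v ∧ δ v + 1 = δ u) (u : M) :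
    ∃ p : T.Walk u g, p.length = δ u := by
  induction hn : δ u generalizing u with
  | zero =>
    by_cases hug : u = g
    · subst hug
      exact ⟨.nil, rfl⟩
    · obtain ⟨v, -, hv⟩ := hdescent u hug
      omega
  | succ n ih =>
    obtain ⟨v, huv, hv⟩ := hdescent u (by rintro rfl; omega)
    obtain ⟨p, hp⟩ := ih v (by omega)
    exact ⟨.cons huv p, by rw [Walk.length_cons, hp]⟩

theorem le_length_of_adj_le_add_one {g : M} {δ : M → ℕ} (hzero : δ g = 0)
    (hadj : ∀ u v, T.Adj u v → δ u ≤ δ v + 1) {u : M} (p : T.Walk u g) : δ u ≤ p.length := by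
  induction p with
  | nil => simp [hzero]
  | cons huv p ih => exact (hadj _ _ huv).trans (Nat.succ_le_succ (ih hzero))

theorem dist_eq_of_descent {g : M} {δ : M → ℕ} (hzero : δ g = 0)
    (hadj : ∀ u v, T.Adj u v → δ u ≤ δ v + 1)
    (hdescent : ∀ u, u ≠ g → ∃ v, T.Adj u v ∧ δ v + 1 = δ u) (u : M) : T.dist u g = δ u := by
  obtain ⟨p, hp⟩ := exists_walk_length_eq_of_descent hzero hdescent u
  obtain ⟨q, hq⟩ := p.reachable.exists_walk_length_eq_dist
  exact le_antisymm (hp ▸ dist_le p) (hq ▸ le_length_of_adj_le_add_one hzero hadj q)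

theorem geodInterval_self (hT : T.Preconnected) (a : M) : T.geodInterval a a = {a} := by
  ext x
  rw [mem_geodInterval, dist_self, Set.mem_singleton_iff, ← (hT x a).dist_eq_zero_iff,
    T.dist_comm (u := a)]
  omega

theorem geodInterval_subset_pair_of_adj (hT : T.Preconnected) {a b : M} (hab : T.Adj a b) :
    T.geodInterval a b ⊆ {a, b} := by
  intro x hx
  rw [mem_geodInterval, dist_eq_one_iff_adj.mpr hab] at hx
  rcases (by omega : T.dist a x = 0 ∨ T.dist x b = 0) with h | h
  · exact Or.inl ((hT a x).dist_eq_zero_iff.mp h).symm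
  · exact Or.inr ((hT x b).dist_eq_zero_iff.mp h)

theorem isGeodConvex_singleton (hT : T.Preconnected) (a : M) : T.IsGeodConvex {a} := by
  rintro _ rfl _ rfl
  exact (geodInterval_self hT _).subset

theorem isGeodConvex_pair_of_adj (hT : T.Preconnected) {a b : M} (hab : T.Adj a b) :
    T.IsGeodConvex {a, b} := by
  rintro _ (rfl | rfl) _ (rfl | rfl)
  · exact (geodInterval_self hT _).subset.trans (by simp)
  · exact geodInterval_subset_pair_of_adj hT hab
  · exact Set.pair_comm _ _ ▸ geodInterval_subset_pair_of_adj hT hab.symm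
  · exact (geodInterval_self hT _).subset.trans (by simp)

theorem isGeodConvex_univ : T.IsGeodConvex Set.univ :=
  fun _ _ _ _ => Set.subset_univ _

theorem SimpleGraph.IsGeodConvex.eq_of_forall_adj {S : Set M} (hS : T.IsGeodConvex S)
    (hT : T.Preconnected) {α : Type*} {f : M → α}
    (hf : ∀ a ∈ S, ∀ b ∈ S, T.Adj a b → f a = f b) {a b : M} (ha : a ∈ S) (hb : b ∈ S) :
    f a = f b := by
  induction hn : T.dist a b generalizing a with
  | zero => rw [(hT a b).dist_eq_zero_iff.mp hn]
  | succ n ih =>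
    obtain ⟨x, hax, hx⟩ := exists_adj_dist_add_one_eq (hT a b) (by rintro rfl; simp at hn)
    have hxS : x ∈ S := hS a ha b hb (by
      rw [mem_geodInterval, dist_eq_one_iff_adj.mpr hax]; omega)
    exact (hf a ha x hxS hax).trans (ih hxS (by omega))

end Distance

/-- A four-cycle of `T`, its vertices listed in cyclic order. The edges `a b` and `d c` are
opposite, and so are `a d` and `b c`. -/
structure IsFourCycle {M : Type*} (T : SimpleGraph M) (a b c d : M) : Prop where
  adj_ab : T.Adj a b
  adj_bc : T.Adj b c
  adj_dc : T.Adj d c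
  adj_ad : T.Adj a d
  ne_ac : a ≠ c
  ne_bd : b ≠ d

namespace IsFourCycle

variable {M : Type*} {T : SimpleGraph M} {a b c d : M}

theorem reflect (h : IsFourCycle T a b c d) : IsFourCycle T b a d c :=
  ⟨h.adj_ab.symm, h.adj_ad, h.adj_dc.symm, h.adj_bc, h.ne_bd, h.ne_ac⟩

theorem transpose (h : IsFourCycle T a b c d) : IsFourCycle T a d c b :=
  ⟨h.adj_ad, h.adj_dc, h.adj_bc, h.adj_ab, h.ne_ac, h.ne_bd.symm⟩

theorem opposite (h : IsFourCycle T a b c d) : IsFourCycle T d c b a :=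
  ⟨h.adj_dc, h.adj_bc.symm, h.adj_ab, h.adj_ad.symm, h.ne_bd.symm, h.ne_ac.symm⟩

end IsFourCycle

namespace SimpleGraph.IsMedian

variable {M : Type*} {T : SimpleGraph M}

theorem dist_ne_of_adj (hT : T.IsMedian) {a b : M} (hab : T.Adj a b) (v : M) :
    T.dist v a ≠ T.dist v b := by
  intro heq
  obtain ⟨x, ⟨⟨hx_ab, hx_bv⟩, hx_va⟩, -⟩ := hT.existsUnique_median a b v
  rw [mem_geodInterval] at hx_ab hx_bv hx_va
  rw [dist_eq_one_iff_adj.mpr hab] at hx_ab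
  grind [SimpleGraph.dist_comm]

theorem dist_eq_add_one_or_of_adj (hT : T.IsMedian) {a b : M} (hab : T.Adj a b) (v : M) :
    T.dist v b = T.dist v a + 1 ∨ T.dist v a = T.dist v b + 1 := by
  have hne := hT.dist_ne_of_adj hab v
  rcases hab.diff_dist_adj (u := v) with h | h | h <;> omega

theorem compl_wSet (hT : T.IsMedian) {a b : M} (hab : T.Adj a b) :
    (T.wSet a b)ᶜ = T.wSet b a := by
  ext v
  have hne := hT.dist_ne_of_adj hab v
  simp only [Set.mem_compl_iff, mem_wSet]
  omega

theorem mem_wSet_iff_mem_geodInterval (hT : T.IsMedian) {a b v : M} (hab : T.Adj a b) :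
    v ∈ T.wSet b a ↔ b ∈ T.geodInterval a v := by
  have hcases := hT.dist_eq_add_one_or_of_adj hab v
  rw [mem_wSet, mem_geodInterval, dist_eq_one_iff_adj.mpr hab, T.dist_comm (u := a),
    T.dist_comm (u := b)]
  omega

theorem exists_isFourCycle (hT : T.IsMedian) {a b d r : M} (hab : T.Adj a b) (had : T.Adj a d)
    (hbd : b ≠ d) (hb : T.dist b r + 1 = T.dist a r) (hd : T.dist d r + 1 = T.dist a r) :
    ∃ c, IsFourCycle T a b c d ∧ T.dist c r + 2 = T.dist a r := by
  obtain ⟨c, ⟨⟨hc_bd, hc_dr⟩, hc_rb⟩, -⟩ := hT.existsUnique_median b d r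
  rw [mem_geodInterval] at hc_bd hc_dr hc_rb
  have hpos := hT.connected.pos_dist_of_ne hbd
  have htriangle := hT.connected.dist_triangle (u := b) (v := a) (w := d)
  rw [dist_eq_one_iff_adj.mpr hab.symm, dist_eq_one_iff_adj.mpr had] at htriangle
  have hdc : T.dist d c = 1 := by grind [SimpleGraph.dist_comm]
  have hbc : T.dist b c = 1 := by grind [SimpleGraph.dist_comm]
  have hcr : T.dist c r + 2 = T.dist a r := by omega
  exact ⟨c, ⟨hab, dist_eq_one_iff_adj.mp hbc, dist_eq_one_iff_adj.mp hdc, had,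
    by rintro rfl; omega, hbd⟩, hcr⟩

end SimpleGraph.IsMedian

namespace IsFourCycle

open SimpleGraph

variable {M : Type*} {T : SimpleGraph M} {a b c d : M}

theorem dist_eq_two (h : IsFourCycle T a b c d) (hT : T.IsMedian) : T.dist a c = 2 := by
  have hab := dist_eq_one_iff_adj.mpr h.adj_ab
  have hpos := hT.connected.pos_dist_of_ne h.ne_ac
  rcases hT.dist_eq_add_one_or_of_adj h.adj_bc a with hac | hac <;> omega

theorem wSet_subset (h : IsFourCycle T a b c d) (hT : T.IsMedian) :
    T.wSet a b ⊆ T.wSet d c := by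
  intro v hab
  by_contra hdc
  replace hdc : v ∈ T.wSet c d := hT.compl_wSet h.adj_dc ▸ hdc
  rw [mem_wSet] at hab hdc
  -- Otherwise both `a` and `c` would be medians of `b`, `d` and `v`.
  have := hT.dist_eq_add_one_or_of_adj h.adj_ab v
  have := hT.dist_eq_add_one_or_of_adj h.adj_bc v
  have := hT.dist_eq_add_one_or_of_adj h.adj_dc v
  have := hT.dist_eq_add_one_or_of_adj h.adj_ad v
  have := h.reflect.dist_eq_two hT
  have := dist_eq_one_iff_adj.mpr h.adj_ab
  have := dist_eq_one_iff_adj.mpr h.adj_bc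
  have := dist_eq_one_iff_adj.mpr h.adj_dc
  have := dist_eq_one_iff_adj.mpr h.adj_ad
  refine h.ne_ac ((hT.existsUnique_median b d v).unique ?_ ?_) <;>
    simp only [Set.mem_inter_iff, mem_geodInterval] <;> grind [SimpleGraph.dist_comm]

theorem wSet_eq (h : IsFourCycle T a b c d) (hT : T.IsMedian) : T.wSet a b = T.wSet d c :=
  (h.wSet_subset hT).antisymm (h.opposite.wSet_subset hT)

end IsFourCycle

/-- The holonomy along a walk of a labelling `σ` of the darts by elements of a monoid: the product
of the labels, in the order in which the walk traverses them. -/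
def holonomy {M Γ : Type*} [Monoid Γ] {T : SimpleGraph M} (σ : M → M → Γ) {a b : M}
    (p : T.Walk a b) : Γ :=
  (p.darts.map fun e => σ e.fst e.snd).prod

theorem holonomy_cons {M Γ : Type*} [Monoid Γ] {T : SimpleGraph M} (σ : M → M → Γ) {a b c : M}
    (hab : T.Adj a b) (p : T.Walk b c) : holonomy σ (.cons hab p) = σ a b * holonomy σ p := by
  simp [holonomy]

namespace SimpleGraph.IsMedian

variable {M : Type*} {T : SimpleGraph M}

theorem exists_isFourCycle_of_crossing (hT : T.IsMedian) {a b x y : M} (hab : T.Adj a b)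
    (hxy : T.Adj x y) (hx : x ∈ T.wSet a b) (hy : y ∈ T.wSet b a) (hxa : x ≠ a) :
    ∃ x' y', IsFourCycle T x y y' x' ∧ x' ∈ T.wSet a b ∧ y' ∈ T.wSet b a ∧
      T.dist x' a + 1 = T.dist x a := by
  obtain ⟨x', hxx', hx'a⟩ := exists_adj_dist_add_one_eq (hT.connected x a) hxa
  rw [mem_wSet] at hx hy
  have hx'_ab := hT.dist_eq_add_one_or_of_adj hab x'
  have hy_ab := hT.dist_eq_add_one_or_of_adj hab y
  have ha_xy := hT.dist_eq_add_one_or_of_adj hxy a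
  have hb_xy := hT.dist_eq_add_one_or_of_adj hxy b
  have hb_xx' := hT.dist_eq_add_one_or_of_adj hxx' b
  simp only [T.dist_comm (u := a), T.dist_comm (u := b)] at ha_xy hb_xy hb_xx'
  have hyx' : y ≠ x' := by rintro rfl; omega
  obtain ⟨y', hcycle, hy'b⟩ :=
    hT.exists_isFourCycle (r := b) hxy hxx' hyx' (by omega) (by omega)
  refine ⟨x', y', hcycle, by rw [mem_wSet]; omega, ?_, hx'a⟩
  have hy'_ab := hT.dist_eq_add_one_or_of_adj hab y'
  have ha_yy' := hT.dist_eq_add_one_or_of_adj hcycle.adj_bc a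
  simp only [T.dist_comm (u := a)] at ha_yy'
  rw [mem_wSet]
  omega

theorem crossing_induction (hT : T.IsMedian) {a b : M} (hab : T.Adj a b) {P : M → M → Prop}
    (base : P a b) (step : ∀ x y y' x', IsFourCycle T x y y' x' → P x' y' → P x y) {x y : M}
    (hxy : T.Adj x y) (hx : x ∈ T.wSet a b) (hy : y ∈ T.wSet b a) : P x y := by
  induction hn : T.dist x a generalizing x y with
  | zero =>
    obtain rfl : x = a := hT.connected.dist_eq_zero_iff.mp hn
    rw [mem_wSet, T.dist_comm (v := x), dist_eq_one_iff_adj.mpr hxy] at hy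
    obtain rfl : y = b := hT.connected.dist_eq_zero_iff.mp (by omega)
    exact base
  | succ n ih =>
    obtain ⟨x', y', hcycle, hx', hy', hdist⟩ :=
      hT.exists_isFourCycle_of_crossing hab hxy hx hy (by rintro rfl; simp at hn)
    exact step x y y' x' hcycle (ih hcycle.adj_dc hx' hy' (by omega))

theorem wSet_eq_of_crossing (hT : T.IsMedian) {a b x y : M} (hab : T.Adj a b)
    (hxy : T.Adj x y) (hx : x ∈ T.wSet a b) (hy : y ∈ T.wSet b a) : T.wSet x y = T.wSet a b :=
  hT.crossing_induction (P := fun x y => T.wSet x y = T.wSet a b) hab rfl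
    (fun _ _ _ _ hcycle h => (hcycle.wSet_eq hT).trans h) hxy hx hy

theorem uSet_eq_of_wSet_eq (hT : T.IsMedian) {a b x y : M} (hab : T.Adj a b) (hxy : T.Adj x y)
    (h : T.wSet x y = T.wSet a b) : T.uSet x y = T.uSet a b := by
  rw [uSet, uSet, ← hT.compl_wSet hxy, ← hT.compl_wSet hab, h]

theorem holonomy_eq_of_length_eq_dist (hT : T.IsMedian) {Γ : Type*} [Monoid Γ] {σ : M → M → Γ}
    (hσ : ∀ a b c d, IsFourCycle T a b c d → σ a b * σ b c = σ a d * σ d c) {a r : M}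
    {p q : T.Walk a r} (hp : p.length = T.dist a r) (hq : q.length = T.dist a r) :
    holonomy σ p = holonomy σ q := by
  induction hn : T.dist a r generalizing a with
  | zero =>
    obtain rfl : a = r := hT.connected.dist_eq_zero_iff.mp hn
    rw [Walk.eq_nil_iff_nil.mpr (Walk.length_eq_zero_iff.mp (hp.trans hn)),
      Walk.eq_nil_iff_nil.mpr (Walk.length_eq_zero_iff.mp (hq.trans hn))]
  | succ n ih =>
    obtain ⟨b, hab, p, rfl⟩ := Walk.exists_eq_cons_of_ne (by rintro rfl; simp at hn) p
    obtain ⟨d, had, q, rfl⟩ := Walk.exists_eq_cons_of_ne (by rintro rfl; simp at hn) q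
    rw [Walk.length_cons] at hp hq
    have hb : T.dist b r + 1 = T.dist a r := by
      have := dist_le p
      rcases hT.dist_eq_add_one_or_of_adj hab r with h | h <;> grind [SimpleGraph.dist_comm]
    have hd : T.dist d r + 1 = T.dist a r := by
      have := dist_le q
      rcases hT.dist_eq_add_one_or_of_adj had r with h | h <;> grind [SimpleGraph.dist_comm]
    rw [holonomy_cons, holonomy_cons]
    by_cases hbd : b = d
    · subst hbd
      rw [ih (p := p) (q := q) (by omega) (by omega) (by omega)]
    · obtain ⟨c, hcycle, hc⟩ := hT.exists_isFourCycle hab had hbd hb hd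
      obtain ⟨s, hs⟩ := hT.connected.exists_walk_length_eq_dist c r
      have hp_eq : holonomy σ p = holonomy σ (.cons hcycle.adj_bc s) :=
        ih (by omega) (by rw [Walk.length_cons]; omega) (by omega)
      have hq_eq : holonomy σ q = holonomy σ (.cons hcycle.adj_dc s) :=
        ih (by omega) (by rw [Walk.length_cons]; omega) (by omega)
      rw [hp_eq, hq_eq, holonomy_cons, holonomy_cons, ← mul_assoc, ← mul_assoc, hσ a b c d hcycle]

theorem exists_potential (hT : T.IsMedian) {Γ : Type*} [Group Γ] {σ : M → M → Γ}
    (hinv : ∀ a b, T.Adj a b → σ b a = (σ a b)⁻¹)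
    (hσ : ∀ a b c d, IsFourCycle T a b c d → σ a b * σ b c = σ a d * σ d c) :
    ∃ π : M → Γ, ∀ a b, T.Adj a b → π a = σ a b * π b := by
  obtain ⟨r⟩ := hT.connected.nonempty
  choose p hp using fun a => hT.connected.exists_walk_length_eq_dist a r
  have hdown : ∀ a b, T.Adj a b → T.dist r a = T.dist r b + 1 →
      holonomy σ (p a) = σ a b * holonomy σ (p b) := by
    intro a b hab hdist
    rw [← holonomy_cons σ hab]
    refine hT.holonomy_eq_of_length_eq_dist hσ (hp a) ?_
    rw [Walk.length_cons, hp b, T.dist_comm, T.dist_comm (u := a), hdist]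
  refine ⟨fun a => holonomy σ (p a), fun a b hab => ?_⟩
  beta_reduce
  rcases hT.dist_eq_add_one_or_of_adj hab r with h | h
  · rw [hdown b a hab.symm h, hinv a b hab, mul_inv_cancel_left]
  · exact hdown a b hab h

end SimpleGraph.IsMedian

/-- A permutation that swaps the only element of `A \ B` with the only element of `B \ A`, and so
carries `A` to `B` and `B` to `A`. -/
def IsExchange {V : Type*} [DecidableEq V] (A B : Set V) (τ : Equiv.Perm V) : Prop :=
  ∃ p q, A \ B = {p} ∧ B \ A = {q} ∧ τ = Equiv.swap p q

namespace IsExchange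

variable {V : Type*} [DecidableEq V] {A B C D : Set V} {τ ρ : Equiv.Perm V}

theorem symm (h : IsExchange A B τ) : IsExchange B A τ := by
  obtain ⟨p, q, hp, hq, rfl⟩ := h
  exact ⟨q, p, hq, hp, Equiv.swap_comm p q⟩

theorem congr (h : IsExchange A B τ) (hAB : A \ B = C \ D) (hBA : B \ A = D \ C) :
    IsExchange C D τ := by
  obtain ⟨p, q, hp, hq, rfl⟩ := h
  exact ⟨p, q, hAB ▸ hp, hBA ▸ hq, rfl⟩

theorem unique (hτ : IsExchange A B τ) (hρ : IsExchange A B ρ) : τ = ρ := by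
  obtain ⟨p, q, hp, hq, rfl⟩ := hτ
  obtain ⟨p', q', hp', hq', rfl⟩ := hρ
  rw [Set.singleton_eq_singleton_iff.mp (hp.symm.trans hp'),
    Set.singleton_eq_singleton_iff.mp (hq.symm.trans hq')]

theorem inv_eq_self (h : IsExchange A B τ) : τ⁻¹ = τ := by
  obtain ⟨p, q, -, -, rfl⟩ := h
  exact Equiv.swap_inv p q

theorem apply_eq_self (h : IsExchange A B τ) {v : V} (hv : v ∈ A ↔ v ∈ B) : τ v = v := by
  obtain ⟨p, q, hp, hq, rfl⟩ := h
  have hpAB : p ∈ A \ B := hp ▸ rfl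
  have hqBA : q ∈ B \ A := hq ▸ rfl
  refine Equiv.swap_apply_of_ne_of_ne ?_ ?_
  · rintro rfl
    exact hpAB.2 (hv.mp hpAB.1)
  · rintro rfl
    exact hqBA.2 (hv.mpr hqBA.1)

theorem apply_mem_iff (h : IsExchange A B τ) {v : V} : τ v ∈ A ↔ v ∈ B := by
  by_cases hv : v ∈ A ↔ v ∈ B
  · rw [h.apply_eq_self hv, hv]
  obtain ⟨p, q, hp, hq, rfl⟩ := h
  have hpAB : p ∈ A \ B := hp ▸ rfl
  have hqBA : q ∈ B \ A := hq ▸ rfl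
  by_cases hvA : v ∈ A
  · obtain rfl : v = p := Set.mem_singleton_iff.mp (hp ▸ ⟨hvA, by tauto⟩)
    simp [hpAB.2, hqBA.2]
  · obtain rfl : v = q := Set.mem_singleton_iff.mp (hq ▸ ⟨by tauto, hvA⟩)
    simp [hpAB.1, hqBA.1]

theorem commute_of_sdiff_eq (hτ : IsExchange A B τ) (hρ : IsExchange A D ρ)
    (hAD : A \ D = B \ C) (hDA : D \ A = C \ B) : Commute τ ρ := by
  obtain ⟨p, q, hp, hq, rfl⟩ := hρ
  have hpA : p ∈ A \ D := hp ▸ rfl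
  have hqA : q ∈ D \ A := hq ▸ rfl
  have hpB : p ∈ B \ C := hAD ▸ hpA
  have hqB : q ∈ C \ B := hDA ▸ hqA
  rw [Commute, SemiconjBy, Equiv.mul_swap_eq_swap_mul,
    hτ.apply_eq_self (iff_of_true hpA.1 hpB.1), hτ.apply_eq_self (iff_of_false hqA.2 hqB.2)]

end IsExchange

theorem exists_isExchange {V : Type*} [DecidableEq V] {A B : Set V} (hAB : ∃ p, A \ B = {p})
    (hBA : ∃ q, B \ A = {q}) : ∃ τ, IsExchange A B τ := by
  obtain ⟨p, hp⟩ := hAB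
  obtain ⟨q, hq⟩ := hBA
  exact ⟨Equiv.swap p q, p, q, hp, hq, rfl⟩

namespace SimpleGraph.MedianDecomposition

variable {V M : Type*} {G : SimpleGraph V} {T : SimpleGraph M} {D : MedianDecomposition G T}
  {a b c d : M} {v w : V}

theorem mem_zSet : v ∈ D.zSet a b ↔ ∃ x ∈ T.uSet a b, v ∈ D.bag x := by
  simp [zSet]

theorem bag_subset_zSet (hab : T.Adj a b) : D.bag a ⊆ D.zSet a b :=
  fun _ hv => mem_zSet.mpr ⟨a, left_mem_uSet hab, hv⟩

theorem mem_bag_of_mem_zSet (hab : T.Adj a b) (ha : v ∈ D.bag a) (hb : v ∈ D.zSet b a) :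
    v ∈ D.bag b := by
  obtain ⟨x, hx, hvx⟩ := mem_zSet.mp hb
  exact D.convex_bags v a ha x hvx ((D.isMedian.mem_wSet_iff_mem_geodInterval hab).mp hx.1)

theorem bag_sdiff_subset_zSet_sdiff (hab : T.Adj a b) :
    D.bag a \ D.bag b ⊆ D.zSet a b \ D.zSet b a :=
  fun _ hv => ⟨bag_subset_zSet hab hv.1, fun hb => hv.2 (mem_bag_of_mem_zSet hab hv.1 hb)⟩

theorem zSet_eq_of_isFourCycle (h : IsFourCycle T a b c d) : D.zSet a b = D.zSet d c := by
  rw [zSet, zSet, D.isMedian.uSet_eq_of_wSet_eq h.adj_dc h.adj_ab (h.wSet_eq D.isMedian)]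

theorem zSet_sdiff_eq_of_isFourCycle (h : IsFourCycle T a b c d) :
    D.zSet a b \ D.zSet b a = D.zSet d c \ D.zSet c d := by
  rw [zSet_eq_of_isFourCycle h, zSet_eq_of_isFourCycle h.reflect]

namespace IsThetaSmooth

theorem exists_zSet_sdiff_eq_singleton (hD : D.IsThetaSmooth) (hab : T.Adj a b) :
    ∃ v, D.zSet a b \ D.zSet b a = {v} := by
  obtain ⟨v, -, hv, -⟩ := hD a b hab
  exact ⟨v, hv⟩

theorem eq_of_mem_zSet_sdiff (hD : D.IsThetaSmooth) (hab : T.Adj a b)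
    (hv : v ∈ D.zSet a b \ D.zSet b a) (hw : w ∈ D.zSet a b \ D.zSet b a) : v = w := by
  obtain ⟨u, hu⟩ := hD.exists_zSet_sdiff_eq_singleton hab
  rw [hu, Set.mem_singleton_iff] at hv hw
  rw [hv, hw]

theorem isGeodConvex_support_union (hD : D.IsThetaSmooth) (hab : T.Adj a b)
    (hv : v ∈ D.zSet a b \ D.zSet b a) (hw : w ∈ D.zSet b a \ D.zSet a b) :
    T.IsGeodConvex (D.support v ∪ D.support w) := by
  obtain ⟨va, vb, ha, hb, hconvex⟩ := hD a b hab
  rw [ha, Set.mem_singleton_iff] at hv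
  rw [hb, Set.mem_singleton_iff] at hw
  rwa [hv, hw]

theorem mem_bag_right_of_mem_bag_left (hD : D.IsThetaSmooth) (hab : T.Adj a b)
    (hv : v ∈ D.zSet a b \ D.zSet b a) (hw : w ∈ D.zSet b a \ D.zSet a b) (ha : v ∈ D.bag a) :
    w ∈ D.bag b := by
  obtain ⟨x, hx, hwx⟩ := mem_zSet.mp hw.1
  have hb_mem : b ∈ T.geodInterval a x := (D.isMedian.mem_wSet_iff_mem_geodInterval hab).mp hx.1
  have hb := hD.isGeodConvex_support_union hab hv hw a (.inl ha) x (.inr hwx) hb_mem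
  exact hb.resolve_left fun hvb => hv.2 (bag_subset_zSet hab.symm hvb)

theorem mem_bag_of_isFourCycle (hD : D.IsThetaSmooth) (h : IsFourCycle T a b c d)
    (hv : v ∈ D.zSet a b \ D.zSet b a) (ha : v ∈ D.bag a) : v ∈ D.bag d := by
  obtain ⟨w, hw⟩ := hD.exists_zSet_sdiff_eq_singleton h.adj_ab.symm
  replace hw : w ∈ D.zSet b a \ D.zSet a b := hw ▸ rfl
  have hwb : w ∈ D.bag b := hD.mem_bag_right_of_mem_bag_left h.adj_ab hv hw ha
  have hwd : w ∉ D.bag d := fun hwd =>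
    hw.2 (zSet_eq_of_isFourCycle h ▸ bag_subset_zSet h.adj_dc hwd)
  by_contra hvd
  have hd_mem : d ∈ T.geodInterval a c := by
    rw [mem_geodInterval, h.dist_eq_two D.isMedian, dist_eq_one_iff_adj.mpr h.adj_ad,
      dist_eq_one_iff_adj.mpr h.adj_dc]
  have hwc : w ∉ D.bag c := fun hwc =>
    (hD.isGeodConvex_support_union h.adj_ab hv hw a (.inl ha) c (.inr hwc) hd_mem).elim hvd hwd
  -- So `v` leaves along `a d` and `w` along the opposite edge `b c`.
  have hv_ad : v ∈ D.zSet a d \ D.zSet d a := bag_sdiff_subset_zSet_sdiff h.adj_ad ⟨ha, hvd⟩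
  have hw_ad : w ∈ D.zSet a d \ D.zSet d a :=
    zSet_sdiff_eq_of_isFourCycle h.transpose ▸ bag_sdiff_subset_zSet_sdiff h.adj_bc ⟨hwb, hwc⟩
  exact hv.2 (hD.eq_of_mem_zSet_sdiff h.adj_ad hv_ad hw_ad ▸ hw.1)

theorem zSet_sdiff_subset_bag (hD : D.IsThetaSmooth) (hab : T.Adj a b) :
    D.zSet a b \ D.zSet b a ⊆ D.bag a := by
  intro v hv
  obtain ⟨x, ⟨hx, y, hy, hxy⟩, hvx⟩ := mem_zSet.mp hv.1
  refine (D.isMedian.crossing_induction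
    (P := fun x y => v ∈ D.zSet x y \ D.zSet y x → v ∈ D.bag x → v ∈ D.bag a)
    hab (fun _ => id) (fun x y y' x' hcycle ih hv_xy hvx => ?_) hxy hx hy) ?_ hvx
  · exact ih (zSet_sdiff_eq_of_isFourCycle hcycle ▸ hv_xy)
      (hD.mem_bag_of_isFourCycle hcycle hv_xy hvx)
  · have hwSet := D.isMedian.wSet_eq_of_crossing hab hxy hx hy
    have hwSet' := D.isMedian.wSet_eq_of_crossing hab.symm hxy.symm hy hx
    rwa [zSet, zSet, D.isMedian.uSet_eq_of_wSet_eq hab hxy hwSet,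
      D.isMedian.uSet_eq_of_wSet_eq hab.symm hxy.symm hwSet']

theorem bag_sdiff_eq (hD : D.IsThetaSmooth) (hab : T.Adj a b) :
    D.bag a \ D.bag b = D.zSet a b \ D.zSet b a :=
  (bag_sdiff_subset_zSet_sdiff hab).antisymm fun _ hv =>
    ⟨hD.zSet_sdiff_subset_bag hab hv, fun hb => hv.2 (bag_subset_zSet hab.symm hb)⟩

theorem bag_sdiff_eq_of_isFourCycle (hD : D.IsThetaSmooth) (h : IsFourCycle T a b c d) :
    D.bag a \ D.bag b = D.bag d \ D.bag c := by
  rw [hD.bag_sdiff_eq h.adj_ab, hD.bag_sdiff_eq h.adj_dc, zSet_sdiff_eq_of_isFourCycle h]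

theorem exists_isExchange_bag [DecidableEq V] (hD : D.IsThetaSmooth) (hab : T.Adj a b) :
    ∃ τ, IsExchange (D.bag a) (D.bag b) τ :=
  exists_isExchange (hD.bag_sdiff_eq hab ▸ hD.exists_zSet_sdiff_eq_singleton hab)
    (hD.bag_sdiff_eq hab.symm ▸ hD.exists_zSet_sdiff_eq_singleton hab.symm)

theorem exists_transport [DecidableEq V] (hD : D.IsThetaSmooth) :
    ∃ π : M → Equiv.Perm V,
      ∀ a b, T.Adj a b → IsExchange (D.bag a) (D.bag b) (π a * (π b)⁻¹) := by
  choose! σ hσ using fun a b => hD.exists_isExchange_bag (a := a) (b := b)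
  have hinv : ∀ a b, T.Adj a b → σ b a = (σ a b)⁻¹ := fun a b hab => by
    rw [(hσ a b hab).inv_eq_self, (hσ a b hab).symm.unique (hσ b a hab.symm)]
  have hcycle : ∀ a b c d, IsFourCycle T a b c d → σ a b * σ b c = σ a d * σ d c := by
    intro a b c d h
    have h_ab_dc : σ a b = σ d c :=
      ((hσ a b h.adj_ab).congr (hD.bag_sdiff_eq_of_isFourCycle h)
        (hD.bag_sdiff_eq_of_isFourCycle h.reflect)).unique (hσ d c h.adj_dc)
    have h_ad_bc := hD.bag_sdiff_eq_of_isFourCycle h.transpose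
    have h_da_cb := hD.bag_sdiff_eq_of_isFourCycle h.transpose.reflect
    have hσ_ad_bc : σ a d = σ b c :=
      ((hσ a d h.adj_ad).congr h_ad_bc h_da_cb).unique (hσ b c h.adj_bc)
    rw [← h_ab_dc, ← hσ_ad_bc]
    exact ((hσ a b h.adj_ab).commute_of_sdiff_eq (hσ a d h.adj_ad) h_ad_bc h_da_cb).eq
  obtain ⟨π, hπ⟩ := D.isMedian.exists_potential hinv hcycle
  exact ⟨π, fun a b hab => by rw [hπ a b hab, mul_inv_cancel_right]; exact hσ a b hab⟩

theorem nonempty_coloring_bag (hD : D.IsThetaSmooth) (r : M) :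
    Nonempty (G.Coloring (D.bag r)) := by
  classical
  have hT := D.isMedian.connected.preconnected
  obtain ⟨π, hπ⟩ := hD.exists_transport
  have hinv : ∀ v, ∀ a ∈ D.support v, ∀ b ∈ D.support v, (π a)⁻¹ v = (π b)⁻¹ v := by
    intro v a ha b hb
    refine (D.convex_bags v).eq_of_forall_adj hT (f := fun x => (π x)⁻¹ v)
      (fun x hx y hy hxy => ?_) ha hb
    rw [Equiv.Perm.inv_eq_iff_eq]
    exact ((hπ x y hxy).apply_eq_self (iff_of_true hx hy)).symm
  have hmem : ∀ k a, π r k ∈ D.bag r ↔ π a k ∈ D.bag a := by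
    intro k a
    refine iff_of_eq <| isGeodConvex_univ.eq_of_forall_adj hT (f := fun x => π x k ∈ D.bag x)
      (fun x _ y _ hxy => propext ?_) trivial trivial
    simpa using (hπ x y hxy).apply_mem_iff (v := π y k)
  choose home hhome using D.exists_bag
  refine ⟨Coloring.mk (fun v => ⟨π r ((π (home v))⁻¹ v), (hmem _ (home v)).mpr ?_⟩) ?_⟩
  · simpa using hhome v
  · intro u v huv heq
    obtain ⟨x, hux, hvx⟩ := D.exists_bag_of_adj u v huv
    have hcolor := (π r).injective (Subtype.ext_iff.mp heq)
    rw [hinv u _ (hhome u) x hux, hinv v _ (hhome v) x hvx] at hcolor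
    exact huv.ne ((π x)⁻¹.injective hcolor)

theorem colorable_width [Finite V] [Fintype M] (hD : D.IsThetaSmooth) :
    G.Colorable D.width := by
  obtain ⟨r⟩ := D.isMedian.connected.nonempty
  obtain ⟨C⟩ := hD.nonempty_coloring_bag r
  have := Fintype.ofFinite (D.bag r)
  refine C.colorable.mono ?_
  rw [Fintype.card_eq_nat_card, Nat.card_coe_set_eq]
  exact Finset.le_sup (f := fun a => (D.bag a).ncard) (Finset.mem_univ r)

end IsThetaSmooth

end SimpleGraph.MedianDecomposition

theorem sum_add_apply_eq_of_forall_ne {ι A : Type*} [Fintype ι] [AddCommMonoid A] {f g : ι → A}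
    {i : ι} (h : ∀ j, j ≠ i → f j = g j) : ∑ j, f j + g i = ∑ j, g j + f i := by
  classical
  rw [← Finset.add_sum_erase _ f (Finset.mem_univ i),
    ← Finset.add_sum_erase _ g (Finset.mem_univ i),
    Finset.sum_congr rfl fun j hj => h j (Finset.ne_of_mem_erase hj)]
  abel

/-- The Cartesian product of a family of graphs: two vertices are adjacent if they differ in exactly
one coordinate, and there they are adjacent. -/
def boxPi {ι : Type*} {N : ι → Type*} (T : ∀ i, SimpleGraph (N i)) : SimpleGraph (∀ i, N i) where
  Adj f g := ∃ i, (T i).Adj (f i) (g i) ∧ ∀ j, j ≠ i → f j = g j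
  symm := ⟨fun _ _ ⟨i, hi, hne⟩ => ⟨i, hi.symm, fun j hj => (hne j hj).symm⟩⟩
  loopless := ⟨fun _ ⟨_, hi, _⟩ => hi.ne rfl⟩

section BoxPi

open SimpleGraph

variable {ι : Type*} {N : ι → Type*} {T : ∀ i, SimpleGraph (N i)}

theorem boxPi_adj_update [DecidableEq ι] {f : ∀ i, N i} {i : ι} {x : N i}
    (h : (T i).Adj (f i) x) : (boxPi T).Adj f (Function.update f i x) :=
  ⟨i, by simpa using h, fun _ hj => (Function.update_of_ne hj _ _).symm⟩

theorem exists_boxPi_adj_sum_dist_add_one_eq [Fintype ι] (hT : ∀ i, (T i).Preconnected)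
    {f g : ∀ i, N i} (hfg : f ≠ g) :
    ∃ f', (boxPi T).Adj f f' ∧
      ∑ i, (T i).dist (f' i) (g i) + 1 = ∑ i, (T i).dist (f i) (g i) := by
  classical
  obtain ⟨i, hi⟩ := Function.ne_iff.mp hfg
  obtain ⟨x, hx, hdist⟩ := exists_adj_dist_add_one_eq (hT i (f i) (g i)) hi
  refine ⟨Function.update f i x, boxPi_adj_update hx, ?_⟩
  have hsum := sum_add_apply_eq_of_forall_ne (i := i)
    (f := fun j => (T j).dist (Function.update f i x j) (g j))
    (g := fun j => (T j).dist (f j) (g j)) fun j hj => by rw [Function.update_of_ne hj]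
  rw [Function.update_self] at hsum
  omega

theorem preconnected_boxPi [Finite ι] (hT : ∀ i, (T i).Preconnected) :
    (boxPi T).Preconnected := by
  have := Fintype.ofFinite ι
  intro f g
  obtain ⟨p, -⟩ := exists_walk_length_eq_of_descent
    (δ := fun f => ∑ i, (T i).dist (f i) (g i)) (by simp)
    (fun _ => exists_boxPi_adj_sum_dist_add_one_eq hT) f
  exact p.reachable

theorem dist_boxPi [Fintype ι] (hT : ∀ i, (T i).Preconnected) (f g : ∀ i, N i) :
    (boxPi T).dist f g = ∑ i, (T i).dist (f i) (g i) := by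
  refine dist_eq_of_descent (δ := fun f => ∑ i, (T i).dist (f i) (g i)) (by simp) ?_
    (fun _ => exists_boxPi_adj_sum_dist_add_one_eq hT) f
  rintro f f' ⟨i, hi, hne⟩
  have htriangle := hi.reachable.dist_triangle_left (g i)
  rw [dist_eq_one_iff_adj.mpr hi] at htriangle
  have hsum := sum_add_apply_eq_of_forall_ne (i := i) (f := fun j => (T j).dist (f j) (g j))
    (g := fun j => (T j).dist (f' j) (g j)) fun j hj => by rw [hne j hj]
  omega

theorem mem_geodInterval_boxPi [Finite ι] (hT : ∀ i, (T i).Preconnected) {f g h : ∀ i, N i} :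
    h ∈ (boxPi T).geodInterval f g ↔ ∀ i, h i ∈ (T i).geodInterval (f i) (g i) := by
  have := Fintype.ofFinite ι
  rw [mem_geodInterval, dist_boxPi hT, dist_boxPi hT, dist_boxPi hT, ← Finset.sum_add_distrib,
    Finset.sum_eq_sum_iff_of_le fun i _ => (hT i (f i) (h i)).dist_triangle_left (g i)]
  simp only [Finset.mem_univ, true_implies, mem_geodInterval]

theorem isMedian_boxPi [Finite ι] (hT : ∀ i, (T i).IsMedian) : (boxPi T).IsMedian := by
  have hconn := fun i => (hT i).connected.preconnected
  have := fun i => (hT i).connected.nonempty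
  refine ⟨⟨preconnected_boxPi hconn⟩, fun f g h => ?_⟩
  choose m hm hunique using fun i => (hT i).existsUnique_median (f i) (g i) (h i)
  simp only [Set.mem_inter_iff, mem_geodInterval_boxPi hconn, ← forall_and]
  exact ⟨m, hm, fun m' hm' => funext fun i => hunique i _ (hm' i)⟩

theorem isGeodConvex_preimage_eval [Finite ι] (hT : ∀ i, (T i).Preconnected) {i : ι}
    {S : Set (N i)} (hS : (T i).IsGeodConvex S) :
    (boxPi T).IsGeodConvex (Function.eval i ⁻¹' S) :=
  fun _ hf _ hg _ hh => hS _ hf _ hg ((mem_geodInterval_boxPi hT).mp hh i)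

theorem mem_wSet_boxPi [Finite ι] (hT : ∀ i, (T i).Preconnected) {i : ι} {a b f : ∀ i, N i}
    (hab : ∀ j, j ≠ i → a j = b j) :
    f ∈ (boxPi T).wSet a b ↔ f i ∈ (T i).wSet (a i) (b i) := by
  have := Fintype.ofFinite ι
  have hsum := sum_add_apply_eq_of_forall_ne (i := i) (f := fun j => (T j).dist (f j) (a j))
    (g := fun j => (T j).dist (f j) (b j)) fun j hj => by rw [hab j hj]
  rw [mem_wSet, mem_wSet, dist_boxPi hT, dist_boxPi hT]
  omega

theorem mem_uSet_boxPi [Finite ι] (hT : ∀ i, (T i).Preconnected) {i : ι} {a b f : ∀ i, N i}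
    (hab : ∀ j, j ≠ i → a j = b j) :
    f ∈ (boxPi T).uSet a b ↔ f i ∈ (T i).uSet (a i) (b i) := by
  classical
  have hba : ∀ j, j ≠ i → b j = a j := fun j hj => (hab j hj).symm
  simp only [mem_uSet, mem_wSet_boxPi hT hab, mem_wSet_boxPi hT hba]
  refine and_congr_right fun hf => ⟨?_, ?_⟩
  · rintro ⟨g, hg, k, hk, hne⟩
    obtain rfl : i = k := by
      by_contra hik
      rw [mem_wSet] at hf hg
      rw [hne i hik] at hf
      omega
    exact ⟨g i, hg, hk⟩
  · rintro ⟨x, hx, hfx⟩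
    exact ⟨Function.update f i x, by simpa using hx, boxPi_adj_update hfx⟩

end BoxPi

section PathGraph

open SimpleGraph

theorem dist_pathGraph {n : ℕ} (u v : Fin n) : (pathGraph n).dist u v = Nat.dist u v := by
  refine dist_eq_of_descent (δ := fun w : Fin n => Nat.dist w v) (Nat.dist_self v) ?_ ?_ u
  · intro x y hxy
    rw [pathGraph_adj] at hxy
    simp only [Nat.dist]
    omega
  · intro x hx
    rcases lt_or_gt_of_ne hx with hlt | hlt
    · exact ⟨⟨x + 1, by omega⟩, pathGraph_adj.mpr (.inl rfl), by simp only [Nat.dist]; omega⟩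
    · exact ⟨⟨x - 1, by omega⟩, pathGraph_adj.mpr (.inr (by simp; omega)),
        by simp only [Nat.dist]; omega⟩

theorem geodInterval_pathGraph {n : ℕ} (u v : Fin n) :
    (pathGraph n).geodInterval u v = Set.uIcc u v := by
  ext x
  simp only [mem_geodInterval, dist_pathGraph, Nat.dist, Set.mem_uIcc, Fin.le_def]
  omega

theorem isMedian_pathGraph {n : ℕ} (hn : 0 < n) : (pathGraph n).IsMedian := by
  have : Nonempty (Fin n) := ⟨⟨0, hn⟩⟩
  refine ⟨⟨pathGraph_preconnected n⟩, fun u v w => ?_⟩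
  simp only [geodInterval_pathGraph]
  refine ⟨max (min u v) (min (max u v) w), ?_, fun x hx => ?_⟩
  · simp only [Set.mem_inter_iff, Set.mem_uIcc]
    grind
  · simp only [Set.mem_inter_iff, Set.mem_uIcc] at hx
    grind

theorem uSet_pathGraph {n : ℕ} {x y : Fin n} (hxy : (pathGraph n).Adj x y) :
    (pathGraph n).uSet x y = {x} := by
  refine Set.Subset.antisymm ?_ (Set.singleton_subset_iff.mpr (left_mem_uSet hxy))
  rintro v ⟨hv, w, hw, hvw⟩
  simp only [mem_wSet, dist_pathGraph, Nat.dist] at hv hw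
  rw [pathGraph_adj] at hxy hvw
  exact Fin.ext (by omega)

end PathGraph

theorem apply_mem_range_section_iff {V ι : Type*} {N : ι → Type*} {e : (Σ i, N i) → V}
    (he : Function.Injective e) {f : ∀ i, N i} {i : ι} {x : N i} :
    e ⟨i, x⟩ ∈ Set.range (fun j => e ⟨j, f j⟩) ↔ f i = x := by
  refine ⟨?_, fun h => ⟨i, by rw [← h]⟩⟩
  rintro ⟨j, hj⟩
  cases he hj
  rfl

namespace SimpleGraph.MedianDecomposition

variable {V ι : Type*} {N : ι → Type*} {G : SimpleGraph V} {T : ∀ i, SimpleGraph (N i)}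

/-- The decomposition of a properly coloured graph over a product of median graphs, one for each
colour class, the vertices of the factor serving as names for the vertices of the class. The bag of
a vertex `f` of the product is the transversal of the classes that `f` selects. -/
def ofColorClasses [Finite ι] (E : (Σ i, N i) ≃ V)
    (hE : ∀ i x y, ¬ G.Adj (E ⟨i, x⟩) (E ⟨i, y⟩)) (hT : ∀ i, (T i).IsMedian) :
    MedianDecomposition G (boxPi T) where
  isMedian := isMedian_boxPi hT
  bag f := Set.range fun i => E ⟨i, f i⟩
  exists_bag_of_adj u v huv := by
    classical
    obtain ⟨⟨i, x⟩, rfl⟩ := E.surjective u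
    obtain ⟨⟨j, y⟩, rfl⟩ := E.surjective v
    have hij : i ≠ j := by
      rintro rfl
      exact hE i x y huv
    obtain ⟨f⟩ := (isMedian_boxPi hT).connected.nonempty
    exact ⟨Function.update (Function.update f i x) j y, ⟨i, by simp [hij]⟩, ⟨j, by simp⟩⟩
  exists_bag v := by
    classical
    obtain ⟨⟨i, x⟩, rfl⟩ := E.surjective v
    obtain ⟨f⟩ := (isMedian_boxPi hT).connected.nonempty
    exact ⟨Function.update f i x, i, by simp⟩
  convex_bags v := by
    obtain ⟨⟨i, x⟩, rfl⟩ := E.surjective v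
    simp only [apply_mem_range_section_iff E.injective]
    have hconn := fun i => (hT i).connected.preconnected
    exact isGeodConvex_preimage_eval hconn (isGeodConvex_singleton (hconn i) x)

section OfColorClasses

variable [Finite ι] {E : (Σ i, N i) ≃ V} {hE : ∀ i x y, ¬ G.Adj (E ⟨i, x⟩) (E ⟨i, y⟩)}
  {hT : ∀ i, (T i).IsMedian}

theorem mem_bag_ofColorClasses {f : ∀ i, N i} {i : ι} {x : N i} :
    E ⟨i, x⟩ ∈ (ofColorClasses E hE hT).bag f ↔ f i = x :=
  apply_mem_range_section_iff E.injective

theorem support_ofColorClasses {i : ι} {x : N i} :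
    (ofColorClasses E hE hT).support (E ⟨i, x⟩) = {f | f i = x} := by
  ext f
  rw [support, Set.mem_ofPred_eq, Set.mem_ofPred_eq, mem_bag_ofColorClasses]

theorem ncard_bag_ofColorClasses (f : ∀ i, N i) :
    ((ofColorClasses E hE hT).bag f).ncard = Nat.card ι :=
  Set.ncard_range_of_injective fun _ _ h => congrArg Sigma.fst (E.injective h)

theorem width_ofColorClasses [Fintype (∀ i, N i)] :
    (ofColorClasses E hE hT).width = Nat.card ι := by
  have := (isMedian_boxPi hT).connected.nonempty
  simp only [width, ncard_bag_ofColorClasses]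
  exact Finset.sup_const Finset.univ_nonempty _

theorem zSet_sdiff_ofColorClasses (hU : ∀ i x y, (T i).Adj x y → (T i).uSet x y = {x}) {i : ι}
    {a b : ∀ i, N i} (hi : (T i).Adj (a i) (b i)) (hab : ∀ j, j ≠ i → a j = b j) :
    (ofColorClasses E hE hT).zSet a b \ (ofColorClasses E hE hT).zSet b a = {E ⟨i, a i⟩} := by
  classical
  have hconn := fun i => (hT i).connected.preconnected
  have huSet_ab : ∀ f, f ∈ (boxPi T).uSet a b ↔ f i = a i := fun f => by
    rw [mem_uSet_boxPi hconn hab, hU i _ _ hi, Set.mem_singleton_iff]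
  have huSet_ba : ∀ f, f ∈ (boxPi T).uSet b a ↔ f i = b i := fun f => by
    rw [mem_uSet_boxPi hconn fun j hj => (hab j hj).symm, hU i _ _ hi.symm, Set.mem_singleton_iff]
  ext v
  obtain ⟨⟨j, x⟩, rfl⟩ := E.surjective v
  simp only [Set.mem_sdiff, mem_zSet, huSet_ab, huSet_ba, mem_bag_ofColorClasses,
    Set.mem_singleton_iff, E.apply_eq_iff_eq, not_exists, not_and]
  constructor
  · rintro ⟨⟨f, hfi, rfl⟩, hb⟩
    obtain rfl : j = i := by
      by_contra hji
      exact hb (Function.update f i (b i)) (by simp) (by simp [hji])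
    rw [hfi]
  · rintro ⟨⟩
    exact ⟨⟨a, rfl, rfl⟩, fun f hf h => hi.ne (h.symm.trans hf)⟩

theorem isThetaSmooth_ofColorClasses (hU : ∀ i x y, (T i).Adj x y → (T i).uSet x y = {x}) :
    (ofColorClasses E hE hT).IsThetaSmooth := by
  rintro a b ⟨i, hi, hab⟩
  refine ⟨_, _, zSet_sdiff_ofColorClasses hU hi hab,
    zSet_sdiff_ofColorClasses hU hi.symm fun j hj => (hab j hj).symm, ?_⟩
  have hconn := fun i => (hT i).connected.preconnected
  rw [support_ofColorClasses, support_ofColorClasses]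
  exact isGeodConvex_preimage_eval hconn (isGeodConvex_pair_of_adj (hconn i) hi)

end OfColorClasses

end SimpleGraph.MedianDecomposition

section ChromaticNumber

open SimpleGraph

variable {V : Type*} [Finite V] {G : SimpleGraph V}

theorem card_mem_smoothWidths {ι : Type} [Finite ι] {C : G.Coloring ι}
    (hC : Function.Surjective C) : (Nat.card ι : ℕ∞) ∈ G.smoothWidths := by
  classical
  have := Fintype.ofFinite ι
  let classSize (i : ι) : ℕ := Nat.card {v // C v = i}
  let E : (Σ i, Fin (classSize i)) ≃ V :=
    (Equiv.sigmaCongrRight fun i => (Finite.equivFin {v // C v = i}).symm).trans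
      (Equiv.sigmaFiberEquiv C)
  have hcolor : ∀ i x, C (E ⟨i, x⟩) = i := fun i x => ((Finite.equivFin _).symm x).2
  have hE : ∀ i x y, ¬ G.Adj (E ⟨i, x⟩) (E ⟨i, y⟩) := fun i x y h =>
    C.valid h ((hcolor i x).trans (hcolor i y).symm)
  have hT : ∀ i, (pathGraph (classSize i)).IsMedian := fun i => by
    obtain ⟨v, hv⟩ := hC i
    have : Nonempty {v // C v = i} := ⟨⟨v, hv⟩⟩
    exact isMedian_pathGraph Nat.card_pos
  exact ⟨∀ i, Fin (classSize i), inferInstance, boxPi _, .ofColorClasses E hE hT,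
    MedianDecomposition.isThetaSmooth_ofColorClasses fun _ _ _ => uSet_pathGraph,
    congrArg Nat.cast MedianDecomposition.width_ofColorClasses⟩

theorem chromaticNumber_mem_smoothWidths (G : SimpleGraph V) :
    G.chromaticNumber ∈ G.smoothWidths := by
  have hG := G.colorable_chromaticNumber_of_fintype
  have hcoe : (G.chromaticNumber.toNat : ℕ∞) = G.chromaticNumber :=
    ENat.natCast_toNat (chromaticNumber_ne_top_iff_exists.mpr ⟨_, hG⟩)
  obtain ⟨C⟩ := id hG
  have hC := (chromaticNumber_eq_iff_forall_surjective hG).mp hcoe.symm C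
  simpa only [Nat.card_fin, hcoe] using card_mem_smoothWidths hC

theorem chromaticNumber_mem_lowerBounds_smoothWidths (G : SimpleGraph V) :
    G.chromaticNumber ∈ lowerBounds G.smoothWidths := by
  rintro _ ⟨M, _, T, D, hD, rfl⟩
  exact hD.colorable_width.chromaticNumber_le

end ChromaticNumber

/-- The smooth medianwidth of a finite graph is attained as a minimum, and it equals the
chromatic number. -/
theorem mainTheorem2 {V : Type*} [Finite V] (G : SimpleGraph V) :
    G.smoothMedianwidth ∈ G.smoothWidths ∧ G.smoothMedianwidth = G.chromaticNumber := by
  have hleast : IsLeast G.smoothWidths G.chromaticNumber :=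
    ⟨chromaticNumber_mem_smoothWidths G, chromaticNumber_mem_lowerBounds_smoothWidths G⟩
  have heq : G.smoothMedianwidth = G.chromaticNumber := hleast.isGLB.sInf_eq
  exact ⟨heq ▸ hleast.1, heq⟩
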